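/- Four parties share a no-signalling, not necessarily quantum, resource. Only Charlie's system is assumed to be quantum, with a complex Hilbert space $H$ of arbitrary unknown dimension. When Alice, Bob and Dani use inputs $x,y,w$ and obtain outputs $a,b,d$ ($w\in\{1,2,3\}$, $d\in\{0,1\}$; the output sets of Alice and Bob are finite), Charlie's system is left in the subnormalised state $\sigma_{abd|xyw}$. That is, the $\sigma_{abd|xyw}$ are positive trace-class operators on $H$ with $\sum_{a,b,d}\operatorname{tr}\sigma_{abd|xyw}=1$; moreover $\sum_a\sigma_{abd|xyw}$ does not depend on $x$, $\sum_b\sigma_{abd|xyw}$ does not depend on $y$, and $\sum_d\sigma_{abd|xyw}$ does not depend on $w$. No quantum realisation of this assemblage is assumed. Charlie performs arbitrary two-outcome measurements (POVMs) $\{M_{c|z}\}_{c\in\{0,1\}}$, $z\in\{1,\dots,6\}$, which gives the correlations $$p(abcd|xyzw)=\operatorname{tr}(M_{c|z}\,\sigma_{abd|xyw}),\qquad p(cd|zw)=\sum_{a,b}p(abcd|xyzw),\qquad E_{z,w}=\sum_{c,d}(-1)^{c+d}p(cd|zw),$$ where $p(cd|zw)$ does not depend on $x,y$. Suppose that the marginal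 correlations of Charlie and Dani give the maximal quantum violation of the Bell inequality $\mathcal I^{CD}\le 6$, i.e. $$\mathcal I^{CD}=E_{1,1}+E_{1,2}-E_{2,1}+E_{2,2}+E_{3,1}+E_{4,1}+E_{3,3}-E_{4,3}+E_{5,2}+E_{6,2}+E_{5,3}-E_{6,3}=6\sqrt2 .$$ Then Charlie and Dani's assemblage $\sigma_{d|w}=\sum_{a,b}\sigma_{abd|xyw}$ (which does not depend on $x,y$) is the reference Pauli assemblage up to a channel and an auxiliary state. Precisely, there are $r\in[0,1]$, a density operator $\xi$ on a finite-dimensional space $K$, and a quantum channel (completely positive trace-preserving map) $\Lambda$ from the trace-class operators on $H$ to the operators on $K\otimes\mathbb C^2\otimes\mathbb C^2$ such that for all $d\in\{0,1\}$ and $w\in\{1,2,3\}$ $$\Lambda(\sigma_{d|w})=\xi\otimes\sigma^{R}_{d|w},\qquad \sigma^{R}_{d|w}=r\,\widetilde\sigma^{R}_{d|w}\otimes|0\rangle\langle0|+(1-r)\,(\widetilde\sigma^{R}_{d|w})^{T}\otimes|1\rangle\langle1|,\qquad \widetilde\sigma^{R}_{d|w}=\tfrac12\cdot\tfrac{\mathbb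 I+(-1)^dP_w}{2},$$ where $P_1,P_2,P_3$ are the Pauli matrices $X,Y,Z$ and $T$ is the transpose. -/

import Mathlib

open scoped Kronecker ComplexOrder

namespace PostQuantumSelfTest

noncomputable section

/-! ### Trace-class operators on a Hilbert space of arbitrary dimension -/

section TraceClass

variable (H : Type*) [NormedAddCommGroup H] [InnerProductSpace ℂ H] [CompleteSpace H]

/-- A fixed orthonormal (Hilbert) basis of `H`. Neither the trace class nor the trace of a
trace-class operator depends on which one is used. -/
def onb : HilbertBasis (exists_hilbertBasis ℂ H).choose ℂ H :=
  (exists_hilbertBasis ℂ H).choose_spec.choose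

/-- The trace-class operators: the linear span of the positive operators of finite trace. -/
def traceClass : Submodule ℂ (H →L[ℂ] H) :=
  Submodule.span ℂ
    {T | T.IsPositive ∧ Summable fun i => inner ℂ (onb H i) (T (onb H i))}

variable {H}

/-- The trace `∑ᵢ ⟨eᵢ, T eᵢ⟩` of an operator, meaningful when `T` is trace class. -/
def opTrace (T : H →L[ℂ] H) : ℂ := ∑' i, inner ℂ (onb H i) (T (onb H i))

/-- Positivity of a block operator `(Tᵢⱼ)` acting on `ℂⁿ ⊗ H`. -/
def BlockPositive {n : ℕ} (T : Fin n → Fin n → traceClass H) : Prop :=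
  ∀ v : Fin n → H, 0 ≤ ∑ i, ∑ j, inner ℂ (v i) ((T i j : H →L[ℂ] H) (v j))

/-- A quantum channel from the system `H` to a finite-dimensional system with basis indexed by
`κ`: a completely positive (that is, every amplification `id ⊗ Λ` preserves positivity) and
trace-preserving linear map. -/
structure IsChannel {κ : Type*} [Fintype κ]
    (Λ : traceClass H →ₗ[ℂ] Matrix κ κ ℂ) : Prop where
  completelyPositive : ∀ (n : ℕ) (T : Fin n → Fin n → traceClass H), BlockPositive T →
    (Matrix.of fun (i j : Fin n × κ) => Λ (T i.1 j.1) i.2 j.2).PosSemidef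
  tracePreserving : ∀ T : traceClass H, (Λ T).trace = opTrace (T : H →L[ℂ] H)

end TraceClass

/-! ### Assemblages, measurements and correlations in the four-party scenario -/

section Scenario

variable {H : Type*} [NormedAddCommGroup H] [InnerProductSpace ℂ H] [CompleteSpace H]
variable {A B X Y : Type*} [Fintype A] [Fintype B]

/-- `σ a b d x y w` is the subnormalised state `σ_{abd|xyw}` of Charlie's system. The only
constraints are positivity, normalisation and no-signalling: the resources shared by the
parties need not be quantum. -/
structure IsAssemblage (σ : A → B → Fin 2 → X → Y → Fin 3 → traceClass H) : Prop where
  positive : ∀ a b d x y w, (σ a b d x y w : H →L[ℂ] H).IsPositive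
  normalised : ∀ x y w,
    opTrace ((∑ a, ∑ b, ∑ d, σ a b d x y w : traceClass H) : H →L[ℂ] H) = 1
  noSignallingA : ∀ b d x x' y w, ∑ a, σ a b d x y w = ∑ a, σ a b d x' y w
  noSignallingB : ∀ a d x y y' w, ∑ b, σ a b d x y w = ∑ b, σ a b d x y' w
  noSignallingD : ∀ a b x y w w', ∑ d, σ a b d x y w = ∑ d, σ a b d x y w'

/-- A general measurement (POVM) with two outcomes. -/
structure IsMeasurement (M : Fin 2 → H →L[ℂ] H) : Prop where
  positive : ∀ c, (M c).IsPositive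
  sum_eq_one : ∑ c, M c = 1

/-- The four-party correlations `p(abcd|xyzw) = tr(M_{c|z} σ_{abd|xyw})`. -/
def correlations (σ : A → B → Fin 2 → X → Y → Fin 3 → traceClass H)
    (M : Fin 2 → Fin 6 → H →L[ℂ] H)
    (a : A) (b : B) (c d : Fin 2) (x : X) (y : Y) (z : Fin 6) (w : Fin 3) : ℝ :=
  (opTrace (M c z ∘L (σ a b d x y w : H →L[ℂ] H))).re

/-- The marginal `p(cd|zw) = ∑_{ab} p(abcd|xyzw)` of Charlie and Dani; for no-signalling
correlations it does not depend on the inputs `x` and `y`. -/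
def marginalCD (p : A → B → Fin 2 → Fin 2 → X → Y → Fin 6 → Fin 3 → ℝ) (x : X) (y : Y)
    (c d : Fin 2) (z : Fin 6) (w : Fin 3) : ℝ :=
  ∑ a, ∑ b, p a b c d x y z w

end Scenario

/-- The correlator `E_{z,w} = ∑_{c,d} (-1)^{c+d} p(cd|zw)`. -/
def correlator (p : Fin 2 → Fin 2 → Fin 6 → Fin 3 → ℝ) (z : Fin 6) (w : Fin 3) : ℝ :=
  ∑ c : Fin 2, ∑ d : Fin 2, (-1 : ℝ) ^ ((c : ℕ) + (d : ℕ)) * p c d z w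

/-- The Bell expression `I^CD`, with the settings `z = 1, …, 6` and `w = 1, 2, 3` numbered
from `0`. -/
def bellCD (p : Fin 2 → Fin 2 → Fin 6 → Fin 3 → ℝ) : ℝ :=
  correlator p 0 0 + correlator p 0 1 - correlator p 1 0 + correlator p 1 1
    + correlator p 2 0 + correlator p 3 0 + correlator p 2 2 - correlator p 3 2
    + correlator p 4 1 + correlator p 5 1 + correlator p 4 2 - correlator p 5 2

/-! ### The reference assemblage and self-testing -/

/-- The Pauli matrices `X`, `Y`, `Z`. -/
def pauli : Fin 3 → Matrix (Fin 2) (Fin 2) ℂ :=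
  ![!![0, 1; 1, 0], !![0, -Complex.I; Complex.I, 0], !![1, 0; 0, -1]]

/-- The Pauli assemblage `(1/2) (𝟙 + (-1)^d P_w)/2`, prepared by Pauli measurements on one half
of a two-qubit maximally entangled state. -/
def pauliAssemblage (d : Fin 2) (w : Fin 3) : Matrix (Fin 2) (Fin 2) ℂ :=
  (1 / 4 : ℂ) • (1 + (-1 : ℂ) ^ (d : ℕ) • pauli w)

/-- The reference assemblage `r σ̃ ⊗ |0⟩⟨0| + (1 - r) σ̃ᵀ ⊗ |1⟩⟨1|`. -/
def referenceAssemblage (r : ℝ) (d : Fin 2) (w : Fin 3) :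
    Matrix (Fin 2 × Fin 2) (Fin 2 × Fin 2) ℂ :=
  (r : ℂ) • (pauliAssemblage d w ⊗ₖ Matrix.single 0 0 1)
    + ((1 - r : ℝ) : ℂ) • ((pauliAssemblage d w).transpose ⊗ₖ Matrix.single 1 1 1)

/-- The assemblage `τ` on Charlie's system is the reference assemblage together with an
auxiliary state `ξ`, up to a channel `Λ`, for some value of the unknown parameter `r`. -/
def IsReference {H : Type*} [NormedAddCommGroup H] [InnerProductSpace ℂ H] [CompleteSpace H]
    (τ : Fin 2 → Fin 3 → traceClass H) : Prop :=
  ∃ r : ℝ, 0 ≤ r ∧ r ≤ 1 ∧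
    ∃ (m : ℕ) (ξ : Matrix (Fin m) (Fin m) ℂ)
      (Λ : traceClass H →ₗ[ℂ] Matrix (Fin m × Fin 2 × Fin 2) (Fin m × Fin 2 × Fin 2) ℂ),
      ξ.PosSemidef ∧ ξ.trace = 1 ∧ IsChannel Λ ∧
        ∀ d w, Λ (τ d w) = ξ ⊗ₖ referenceAssemblage r d w

end

end PostQuantumSelfTest

open PostQuantumSelfTest

/-!
Write `S_w = σ_{0|w} - σ_{1|w}` for Dani's steered operators and `ρ = σ_{0|w} + σ_{1|w}` for
Charlie's average state. The Bell expression is the sum of three CHSH expressions, one for each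
pair of Dani's inputs (`bellCD_eq_add_chsh`), so its maximum forces each of them to reach `2√2`.

Tsirelson's bound has a sum-of-squares proof in which only Charlie's observables are operators:
`(C₁ ∓ C₂ ± √2)²` is paired with the ensembles prepared by Dani (`chsh_sum_of_squares`). At the
maximum all squares vanish, and since `tr(A*A T) = 0` gives `A T = 0` for positive `T`, the
operators `X = (C₁ - C₂)/√2` and `Y = (C₁ + C₂)/√2` satisfy `X ρ = S_w`, `X S_w = ρ`, the same
relations for `Y`, and `(XY + YX) ρ = 0` (`chsh_rigidity`). As `S_w` is self-adjoint, these
operators commute with `ρ`; hence the operators found from different pairs can be exchanged for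
one another next to `ρ`, and there is one triple `X₀, X₁, X₂` anticommuting on `ρ`
(`exists_anticommuting_observables`). Restricted to the support `p` of `ρ` the relations hold
exactly (`exists_anticommutingTriple`).

The product `X₀X₁X₂` then is central with square `-p`. Where it is `i` the triple consists of
copies of the Pauli matrices, and where it is `-i` of copies of their transposes. In both blocks
explicit matrix units (`corner`, `IsAnticommutingTriple.corner_relations`) serve as Kraus
operators of a channel that sends `ρ` and `S_w = X_w ρ` to block-diagonal matrices
(`krausMap_extraction_apply`). Since `ρ` commutes with the matrix units, its blocks are multiples
of the identity, which leaves the reference assemblage with a one-dimensional auxiliary space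
(`isReference_of_anticommutingTriple`).

On a space of arbitrary dimension this rests on the cyclicity of the trace, `opTrace_mul_mul`,
which comes from interchanging the summations in the square-summable matrices of Hilbert–Schmidt
operators.
-/

namespace PostQuantumSelfTest

/-! ### Hilbert–Schmidt operators -/

section HilbertSchmidt

variable {H : Type*} [NormedAddCommGroup H] [InnerProductSpace ℂ H] [CompleteSpace H]

/-- Hilbert–Schmidt operators: those with `∑ᵢ ‖S eᵢ‖² < ∞` for the fixed Hilbert basis `onb H`. -/
def IsHilbertSchmidt (S : H →L[ℂ] H) : Prop :=
  Summable fun i => ‖S (onb H i)‖ ^ 2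

theorem hasSum_norm_inner_onb_sq (x : H) :
    HasSum (fun j => ‖inner ℂ (onb H j) x‖ ^ 2) (‖x‖ ^ 2) := by
  have h := (Complex.hasSum_re ((onb H).hasSum_inner_mul_inner x x))
  have e : (inner ℂ x x : ℂ).re = ‖x‖ ^ 2 := inner_self_eq_norm_sq (𝕜 := ℂ) x
  rw [e] at h
  refine h.congr_fun fun j => ?_
  rw [← inner_conj_symm (onb H j) x, RCLike.norm_conj, Complex.mul_conj,
    Complex.normSq_eq_norm_sq, Complex.ofReal_re]

/-- An operator is Hilbert–Schmidt if and only if its matrix is square summable. -/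
theorem isHilbertSchmidt_iff_summable_prod (S : H →L[ℂ] H) :
    IsHilbertSchmidt S ↔
      Summable fun p : _ × _ => ‖inner ℂ (onb H p.2) (S (onb H p.1))‖ ^ 2 := by
  rw [summable_prod_of_nonneg (fun _ => by positivity)]
  simp only [(hasSum_norm_inner_onb_sq _).tsum_eq, (hasSum_norm_inner_onb_sq _).summable,
    implies_true, true_and, IsHilbertSchmidt]

theorem IsHilbertSchmidt.star {S : H →L[ℂ] H} (hS : IsHilbertSchmidt S) :
    IsHilbertSchmidt (star S) := by
  rw [isHilbertSchmidt_iff_summable_prod] at hS ⊢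
  refine (hS.prod_symm).congr fun p => ?_
  rw [ContinuousLinearMap.star_eq_adjoint, ContinuousLinearMap.adjoint_inner_right,
    ← inner_conj_symm, RCLike.norm_conj]
  rfl

theorem IsHilbertSchmidt.mul_left {S : H →L[ℂ] H} (hS : IsHilbertSchmidt S) (B : H →L[ℂ] H) :
    IsHilbertSchmidt (B * S) := by
  refine Summable.of_nonneg_of_le (fun _ => by positivity) (fun i => ?_)
    (Summable.mul_left (‖B‖ ^ 2) hS)
  rw [← mul_pow]
  exact pow_le_pow_left₀ (norm_nonneg _) (B.le_opNorm _) 2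

theorem IsHilbertSchmidt.mul_right {S : H →L[ℂ] H} (hS : IsHilbertSchmidt S) (B : H →L[ℂ] H) :
    IsHilbertSchmidt (S * B) := by
  simpa using (hS.star.mul_left (Star.star B)).star

/-- Interchanging the two summations in a square-summable double series. -/
theorem _root_.HilbertBasis.exists_hasSum_inner {ι : Type*} (b : HilbertBasis ι ℂ H)
    {S R : H →L[ℂ] H} (hS : Summable fun p : ι × ι => ‖inner ℂ (b p.2) (S (b p.1))‖ ^ 2)
    (hR : Summable fun p : ι × ι => ‖inner ℂ (b p.2) (R (b p.1))‖ ^ 2) :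
    ∃ c : ℂ, HasSum (fun i => inner ℂ (S (b i)) (R (b i))) c ∧
      HasSum (fun i => inner ℂ ((star R) (b i)) ((star S) (b i))) c := by
  have hf : Summable fun p : ι × ι =>
      (inner ℂ (S (b p.1)) (b p.2) : ℂ) * inner ℂ (b p.2) (R (b p.1)) := by
    refine Summable.of_norm_bounded (hS.add hR) fun p => ?_
    rw [norm_mul, ← inner_conj_symm (S (b p.1)), RCLike.norm_conj]
    have h2 := two_mul_le_add_sq ‖(inner ℂ (b p.2) (S (b p.1)) : ℂ)‖
      ‖(inner ℂ (b p.2) (R (b p.1)) : ℂ)‖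
    have h0 : 0 ≤ ‖(inner ℂ (b p.2) (S (b p.1)) : ℂ)‖ * ‖(inner ℂ (b p.2) (R (b p.1)) : ℂ)‖ := by
      positivity
    linarith
  have h1 := hf.hasSum
  have h2 := (Equiv.prodComm ι ι).hasSum_iff.2 h1
  refine ⟨_, h1.prod_fiberwise (g := fun i => inner ℂ (S (b i)) (R (b i)))
    fun i => b.hasSum_inner_mul_inner (S (b i)) (R (b i)), h2.prod_fiberwise
    (g := fun j => inner ℂ ((star R) (b j)) ((star S) (b j))) fun j => ?_⟩
  have h3 := b.hasSum_inner_mul_inner ((star R) (b j)) ((star S) (b j))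
  have h4 : ∀ i, (inner ℂ ((star R) (b j)) (b i) * inner ℂ (b i) ((star S) (b j)) : ℂ) =
      inner ℂ (S (b i)) (b j) * inner ℂ (b j) (R (b i)) := fun i => by
    rw [ContinuousLinearMap.star_eq_adjoint, ContinuousLinearMap.star_eq_adjoint,
      ContinuousLinearMap.adjoint_inner_right, ContinuousLinearMap.adjoint_inner_left, mul_comm]
  simp only [h4] at h3
  exact h3

/-- The Hilbert–Schmidt pairing may be computed through the adjoints. -/
theorem IsHilbertSchmidt.exists_hasSum_inner {S R : H →L[ℂ] H} (hS : IsHilbertSchmidt S)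
    (hR : IsHilbertSchmidt R) :
    ∃ c : ℂ, HasSum (fun i => inner ℂ (S (onb H i)) (R (onb H i))) c ∧
      HasSum (fun i => inner ℂ ((Star.star R) (onb H i)) ((Star.star S) (onb H i))) c :=
  (onb H).exists_hasSum_inner ((isHilbertSchmidt_iff_summable_prod S).1 hS)
    ((isHilbertSchmidt_iff_summable_prod R).1 hR)

end HilbertSchmidt

/-! ### The trace of trace-class operators -/

section Trace

variable {H : Type*} [NormedAddCommGroup H] [InnerProductSpace ℂ H] [CompleteSpace H]

theorem opTrace_zero : opTrace (0 : H →L[ℂ] H) = 0 := by simp [opTrace]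

/-- A positive operator of finite trace is the square of a Hilbert–Schmidt operator. -/
theorem exists_sqrt_isHilbertSchmidt {T : H →L[ℂ] H} (hT : T.IsPositive)
    (hs : Summable fun i => inner ℂ (onb H i) (T (onb H i))) :
    ∃ R : H →L[ℂ] H, IsSelfAdjoint R ∧ R * R = T ∧ IsHilbertSchmidt R := by
  have h0 : 0 ≤ T := T.nonneg_iff_isPositive.2 hT
  have hsa : IsSelfAdjoint (CFC.sqrt T) := .of_nonneg (CFC.sqrt_nonneg T)
  have hRR := CFC.sqrt_mul_sqrt_self T h0
  refine ⟨_, hsa, hRR, (Complex.hasSum_re hs.hasSum).summable.congr fun i => ?_⟩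
  conv_lhs => rw [← hRR]
  rw [mul_apply_eq_comp, ← ContinuousLinearMap.adjoint_inner_left,
    ← ContinuousLinearMap.star_eq_adjoint, hsa.star_eq]
  exact inner_self_eq_norm_sq (𝕜 := ℂ) _

/-- The diagonal of `A T B` is summable for trace-class `T`, and its sum depends on `A` and `B`
only through `B A`. -/
theorem exists_hasSum_mul_mul {T : H →L[ℂ] H} (hT : T ∈ traceClass H) :
    ∃ f : (H →L[ℂ] H) → ℂ, ∀ A B : H →L[ℂ] H,
      HasSum (fun i => inner ℂ (onb H i) ((A * T * B) (onb H i))) (f (B * A)) := by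
  induction hT using Submodule.span_induction with
  | mem T h =>
    obtain ⟨R, hsa, rfl, hR⟩ := exists_sqrt_isHilbertSchmidt h.1 h.2
    have key : ∀ A B : H →L[ℂ] H, ∃ c : ℂ,
        HasSum (fun i => inner ℂ (onb H i) ((A * (R * R) * B) (onb H i))) c ∧
        HasSum (fun i => inner ℂ (onb H i) ((R * (B * A) * R) (onb H i))) c := by
      intro A B
      obtain ⟨c, h1, h2⟩ := (hR.mul_right (star A)).exists_hasSum_inner (hR.mul_right B)
      refine ⟨c, ?_, ?_⟩
      · convert h1 using 2 with i
        rw [← ContinuousLinearMap.adjoint_inner_right, ← ContinuousLinearMap.star_eq_adjoint]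
        simp [hsa.star_eq]
      · convert h2 using 2 with i
        rw [← ContinuousLinearMap.adjoint_inner_right, ← ContinuousLinearMap.star_eq_adjoint]
        simp [hsa.star_eq]
    choose c h1 h2 using key
    refine ⟨fun C => c C 1, fun A B => ?_⟩
    have h3 := h2 (B * A) 1
    rw [one_mul] at h3
    change HasSum _ (c (B * A) 1)
    rw [← (h2 A B).unique h3]
    exact h1 A B
  | zero => exact ⟨0, fun A B => by simp⟩
  | add T S _ _ hT hS =>
    obtain ⟨f, hf⟩ := hT
    obtain ⟨g, hg⟩ := hS
    refine ⟨f + g, fun A B => ?_⟩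
    simpa [mul_add, add_mul, inner_add_right] using (hf A B).add (hg A B)
  | smul a T _ hT =>
    obtain ⟨f, hf⟩ := hT
    refine ⟨a • f, fun A B => ?_⟩
    simpa [inner_smul_right] using (hf A B).mul_left a

theorem hasSum_opTrace_mul_mul {T : H →L[ℂ] H} (hT : T ∈ traceClass H) (A B : H →L[ℂ] H) :
    HasSum (fun i => inner ℂ (onb H i) ((A * T * B) (onb H i))) (opTrace (A * T * B)) := by
  obtain ⟨f, hf⟩ := exists_hasSum_mul_mul hT
  rw [opTrace, (hf A B).tsum_eq]
  exact hf A B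

theorem hasSum_opTrace_mul {T : H →L[ℂ] H} (hT : T ∈ traceClass H) (A : H →L[ℂ] H) :
    HasSum (fun i => inner ℂ (onb H i) ((A * T) (onb H i))) (opTrace (A * T)) := by
  simpa using hasSum_opTrace_mul_mul hT A 1

/-- Cyclicity of the trace. -/
theorem opTrace_mul_mul {T : H →L[ℂ] H} (hT : T ∈ traceClass H) (A B : H →L[ℂ] H) :
    opTrace (A * T * B) = opTrace (B * A * T) := by
  obtain ⟨f, hf⟩ := exists_hasSum_mul_mul hT
  have h := hf (B * A) 1
  rw [mul_one, one_mul] at h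
  rw [opTrace, opTrace, (hf A B).tsum_eq, h.tsum_eq]

/-- The pairing `(A, T) ↦ tr(A T)` of bounded operators with trace-class operators. -/
noncomputable def tracePairing : (H →L[ℂ] H) →ₗ[ℂ] traceClass H →ₗ[ℂ] ℂ :=
  LinearMap.mk₂ ℂ (fun A T => opTrace (A * (T : H →L[ℂ] H)))
    (fun A B T => by
      refine (hasSum_opTrace_mul T.2 (A + B)).unique ?_
      simpa [add_mul, inner_add_right] using
        (hasSum_opTrace_mul T.2 A).add (hasSum_opTrace_mul T.2 B))
    (fun c A T => by
      refine (hasSum_opTrace_mul T.2 (c • A)).unique ?_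
      simpa [inner_smul_right] using (hasSum_opTrace_mul T.2 A).mul_left c)
    (fun A T S => by
      refine (hasSum_opTrace_mul (T + S).2 A).unique ?_
      simpa [mul_add, inner_add_right] using
        (hasSum_opTrace_mul T.2 A).add (hasSum_opTrace_mul S.2 A))
    (fun c A T => by
      refine (hasSum_opTrace_mul (c • T).2 A).unique ?_
      simpa [inner_smul_right] using (hasSum_opTrace_mul T.2 A).mul_left c)

theorem tracePairing_apply (A : H →L[ℂ] H) (T : traceClass H) :
    tracePairing A T = opTrace (A * (T : H →L[ℂ] H)) := rfl

/-- `tr(A*A T)` is the squared Hilbert–Schmidt norm of `A √T`. -/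
theorem exists_hasSum_norm_sq {A T : H →L[ℂ] H} (hT : T ∈ traceClass H)
    (hpos : T.IsPositive) : ∃ R : H →L[ℂ] H, IsSelfAdjoint R ∧ R * R = T ∧
      HasSum (fun i => ((‖(A * R) (onb H i)‖ ^ 2 : ℝ) : ℂ)) (opTrace (star A * A * T)) := by
  obtain ⟨R, hsa, rfl, hR⟩ := exists_sqrt_isHilbertSchmidt hpos
    (by simpa using (hasSum_opTrace_mul hT 1).summable)
  refine ⟨R, hsa, rfl, ?_⟩
  obtain ⟨c, h1, h2⟩ := (hR.mul_left A).exists_hasSum_inner (hR.mul_left A)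
  have h3 : c = opTrace (A * (R * R) * star A) := by
    refine h2.unique ?_
    convert hasSum_opTrace_mul_mul hT A (star A) using 2 with i
    rw [← ContinuousLinearMap.adjoint_inner_right, ← ContinuousLinearMap.star_eq_adjoint]
    simp [hsa.star_eq]
  rw [← opTrace_mul_mul hT, ← h3]
  convert h1 using 2 with i
  rw [inner_self_eq_norm_sq_to_K]
  norm_cast

/-- `tr(A*A T) ≥ 0` for positive trace-class `T`. -/
theorem opTrace_star_mul_mul_nonneg {A T : H →L[ℂ] H} (hT : T ∈ traceClass H)
    (hpos : T.IsPositive) : 0 ≤ opTrace (star A * A * T) := by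
  obtain ⟨R, -, -, h⟩ := exists_hasSum_norm_sq (A := A) hT hpos
  exact h.nonneg fun i => by positivity

/-- If `tr(A*A T) = 0` with `T` positive, then `A √T` is zero on a Hilbert basis, so `A T = 0`. -/
theorem mul_eq_zero_of_opTrace_star_mul_mul {A T : H →L[ℂ] H} (hT : T ∈ traceClass H)
    (hpos : T.IsPositive) (h0 : (opTrace (star A * A * T)).re = 0) : A * T = 0 := by
  obtain ⟨R, -, rfl, h⟩ := exists_hasSum_norm_sq (A := A) hT hpos
  have h' := Complex.hasSum_re h
  simp only [Complex.ofReal_re, h0] at h'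
  rw [hasSum_zero_iff_of_nonneg fun i => by positivity] at h'
  have hz : A * R = 0 := by
    refine ContinuousLinearMap.ext_on
      (Submodule.dense_iff_topologicalClosure_eq_top.2 (onb H).dense_span) ?_
    rintro _ ⟨i, rfl⟩
    simpa using congrFun h' i
  rw [← mul_assoc, hz, zero_mul]

end Trace

/-! ### Channels from Kraus operators -/

section Kraus

variable {H : Type*} [NormedAddCommGroup H] [InnerProductSpace ℂ H] [CompleteSpace H]

/-- Over `ℂ`, a matrix with nonnegative quadratic form is automatically Hermitian. -/
theorem posSemidef_of_dotProduct_mulVec_nonneg {n : Type*} [Fintype n]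
    {A : Matrix n n ℂ} (h : ∀ u : n → ℂ, 0 ≤ star u ⬝ᵥ A.mulVec u) : A.PosSemidef := by
  classical
  rw [← Matrix.isPositive_toEuclideanLin_iff, LinearMap.isPositive_iff_complex]
  intro x
  have hx : inner ℂ (Matrix.toEuclideanLin A x) x = star (star x.ofLp ⬝ᵥ A.mulVec x.ofLp) := by
    rw [EuclideanSpace.inner_eq_star_dotProduct, Matrix.dotProduct_star, dotProduct_comm]
    rfl
  obtain ⟨h1, h2⟩ := Complex.le_def.1 (h x.ofLp)
  rw [hx]
  refine ⟨?_, by simpa using h1⟩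
  apply Complex.ext <;> simp [← h2]

/-- The map `T ↦ ∑ₖ V_k T V_k*` for the operators `V_k : H → ℂ^κ ⊗ H`, `V_k v = ∑ₚ p ⊗ F k p v`,
followed by the partial trace over `H`. The `(p, q)` entry `∑ₖ tr(F k p T (F k q)*)` is written
with the operators cyclically permuted. -/
noncomputable def krausMap {ι κ : Type*} [Fintype ι] (F : ι → κ → H →L[ℂ] H) :
    traceClass H →ₗ[ℂ] Matrix κ κ ℂ where
  toFun T := Matrix.of fun p q => ∑ k, tracePairing (star (F k q) * F k p) T
  map_add' T S := by
    ext p q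
    simp [Finset.sum_add_distrib]
  map_smul' c T := by
    ext p q
    simp [Finset.mul_sum]

theorem krausMap_apply {ι κ : Type*} [Fintype ι] (F : ι → κ → H →L[ℂ] H) (T : traceClass H)
    (p q : κ) : krausMap F T p q = ∑ k, tracePairing (star (F k q) * F k p) T := rfl

theorem isChannel_krausMap {ι κ : Type*} [Fintype ι] [Fintype κ] {F : ι → κ → H →L[ℂ] H}
    (hF : ∑ p, ∑ k, star (F k p) * F k p = 1) : IsChannel (krausMap F) where
  tracePreserving T := by
    simp only [Matrix.trace, Matrix.diag, krausMap_apply]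
    have : ∑ p, ∑ k, tracePairing (star (F k p) * F k p) T
        = tracePairing (∑ p, ∑ k, star (F k p) * F k p) T := by
      simp only [map_sum, LinearMap.sum_apply]
    rw [this, hF, tracePairing_apply, one_mul]
  completelyPositive n T hT := by
    refine posSemidef_of_dotProduct_mulVec_nonneg fun u => ?_
    have key : ∀ k, HasSum (fun i => ∑ a, ∑ b,
        inner ℂ (∑ p, u (a, p) • (star (F k p)) (onb H i))
          ((T a b : H →L[ℂ] H) (∑ q, u (b, q) • (star (F k q)) (onb H i))))
        (∑ a, ∑ b, ∑ p, ∑ q, star (u (a, p)) * u (b, q) *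
          tracePairing (star (F k q) * F k p) (T a b)) := by
      intro k
      refine hasSum_sum fun a _ => hasSum_sum fun b _ => ?_
      simp only [sum_inner, map_sum, inner_sum]
      rw [Finset.sum_comm]
      refine hasSum_sum fun q _ => hasSum_sum fun p _ => ?_
      rw [tracePairing_apply, ← opTrace_mul_mul (T a b).2]
      refine ((hasSum_opTrace_mul_mul (T a b).2 (F k p) (star (F k q))).mul_left
        (star (u (a, p)) * u (b, q))).congr_fun fun i => ?_
      rw [map_smul, inner_smul_left, inner_smul_right, ContinuousLinearMap.star_eq_adjoint,
        ContinuousLinearMap.adjoint_inner_left, mul_assoc]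
      rfl
    have hsum : star u ⬝ᵥ (Matrix.of fun (i j : Fin n × κ) =>
        krausMap F (T i.1 j.1) i.2 j.2).mulVec u = ∑ k, ∑ a, ∑ b, ∑ p, ∑ q,
          star (u (a, p)) * u (b, q) * tracePairing (star (F k q) * F k p) (T a b) := by
      simp only [dotProduct, Matrix.mulVec, Matrix.of_apply, krausMap_apply, Finset.mul_sum,
        Finset.sum_mul, Fintype.sum_prod_type, Pi.star_apply]
      symm
      rw [Finset.sum_comm]
      refine Finset.sum_congr rfl fun a _ => ?_
      rw [Finset.sum_comm]
      conv_rhs => rw [Finset.sum_comm]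
      refine Finset.sum_congr rfl fun b _ => ?_
      rw [Finset.sum_comm]
      refine Finset.sum_congr rfl fun p _ => ?_
      rw [Finset.sum_comm]
      refine Finset.sum_congr rfl fun q _ => Finset.sum_congr rfl fun k _ => ?_
      ring
    rw [hsum]
    exact Finset.sum_nonneg fun k _ => (key k).nonneg fun i => hT _

end Kraus

/-! ### Rigidity of the maximal CHSH violation -/

section CHSH

variable {H : Type*} [NormedAddCommGroup H] [InnerProductSpace ℂ H] [CompleteSpace H]

theorem exists_star_mul_self_of_isPositive {B : H →L[ℂ] H} (hB : B.IsPositive) :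
    ∃ A : H →L[ℂ] H, star A * A = B := by
  have h0 : 0 ≤ B := B.nonneg_iff_isPositive.2 hB
  have hsa : IsSelfAdjoint (CFC.sqrt B) := .of_nonneg (CFC.sqrt_nonneg B)
  exact ⟨CFC.sqrt B, by rw [hsa.star_eq, CFC.sqrt_mul_sqrt_self B h0]⟩

theorem tracePairing_re_nonneg {B : H →L[ℂ] H} (hB : B.IsPositive) {T : traceClass H}
    (hT : (T : H →L[ℂ] H).IsPositive) : 0 ≤ (tracePairing B T).re := by
  obtain ⟨A, rfl⟩ := exists_star_mul_self_of_isPositive hB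
  exact (Complex.le_def.1 (opTrace_star_mul_mul_nonneg (A := A) T.2 hT)).1

theorem mul_eq_zero_of_tracePairing_re {B : H →L[ℂ] H} (hB : B.IsPositive) {T : traceClass H}
    (hT : (T : H →L[ℂ] H).IsPositive) (h : (tracePairing B T).re = 0) :
    B * (T : H →L[ℂ] H) = 0 := by
  obtain ⟨A, rfl⟩ := exists_star_mul_self_of_isPositive hB
  rw [mul_assoc, mul_eq_zero_of_opTrace_star_mul_mul T.2 hT h, mul_zero]

/-- The observable `M₀ - M₁` of a two-outcome measurement. -/
def observable (M : Fin 2 → H →L[ℂ] H) : H →L[ℂ] H := M 0 - M 1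

theorem IsMeasurement.isSelfAdjoint_observable {M : Fin 2 → H →L[ℂ] H} (hM : IsMeasurement M) :
    IsSelfAdjoint (observable M) :=
  (hM.positive 0).isSelfAdjoint.sub (hM.positive 1).isSelfAdjoint

theorem IsMeasurement.isPositive_one_sub_observable_sq {M : Fin 2 → H →L[ℂ] H}
    (hM : IsMeasurement M) : (1 - observable M * observable M).IsPositive := by
  have h1 : M 1 = 1 - M 0 := by
    have := hM.sum_eq_one
    rw [Fin.sum_univ_two] at this
    exact eq_sub_of_add_eq' this
  have hc : ∀ {S T : H →L[ℂ] H}, S.IsPositive → T.IsPositive → (S * T * S).IsPositive := by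
    intro S T hS hT
    have := hT.conj_adjoint S
    rwa [← ContinuousLinearMap.star_eq_adjoint, hS.isSelfAdjoint.star_eq] at this
  -- `1 - (M₀ - M₁)² = 4 M₀ M₁ = 4 (M₀ M₁ M₀ + M₁ M₀ M₁)`, since `M₀ + M₁ = 1`.
  have h2 : 1 - observable M * observable M =
      (4 : ℂ) • (M 0 * M 1 * M 0 + M 1 * M 0 * M 1) := by
    rw [observable, h1, ofNat_smul_eq_nsmul]
    noncomm_ring
  rw [h2]
  exact ((hc (hM.positive 0) (hM.positive 1)).add
    (hc (hM.positive 1) (hM.positive 0))).smul_of_nonneg (by norm_num)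

theorem IsSelfAdjoint.isPositive_mul_self {A : H →L[ℂ] H} (hA : IsSelfAdjoint A) :
    (A * A).IsPositive := by
  have := ContinuousLinearMap.isPositive_adjoint_comp_self A
  rwa [← ContinuousLinearMap.star_eq_adjoint, hA.star_eq] at this

variable {C₁ C₂ : H →L[ℂ] H} {s t : Fin 2 → traceClass H} {ρ : traceClass H}

/-- The CHSH expression `⟨C₁ (S + S')⟩ + ⟨C₂ (S' - S)⟩` regrouped, where `S = s 0 - s 1` and
`S' = t 0 - t 1`. -/
noncomputable def chsh (C₁ C₂ : H →L[ℂ] H) (s t : Fin 2 → traceClass H) : ℝ :=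
  (tracePairing (C₁ - C₂) (s 0 - s 1)).re + (tracePairing (C₁ + C₂) (t 0 - t 1)).re

/-- The sum-of-squares certificate for Tsirelson's bound, with Charlie's operators
`C₁ ∓ C₂ ± √2` evaluated on the ensembles that the other party prepares. -/
theorem chsh_sum_of_squares (hs : s 0 + s 1 = ρ) (ht : t 0 + t 1 = ρ)
    (hρ : opTrace (ρ : H →L[ℂ] H) = 1) {r : ℂ} (hr : r * r = 2) :
    tracePairing ((C₁ - C₂ - r • 1) * (C₁ - C₂ - r • 1)) (s 0)
      + tracePairing ((C₁ - C₂ + r • 1) * (C₁ - C₂ + r • 1)) (s 1)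
      + tracePairing ((C₁ + C₂ - r • 1) * (C₁ + C₂ - r • 1)) (t 0)
      + tracePairing ((C₁ + C₂ + r • 1) * (C₁ + C₂ + r • 1)) (t 1)
      + 2 * tracePairing (1 - C₁ * C₁) ρ + 2 * tracePairing (1 - C₂ * C₂) ρ
      = 8 - 2 * r * (tracePairing (C₁ - C₂) (s 0 - s 1)
          + tracePairing (C₁ + C₂) (t 0 - t 1)) := by
  have h1 : tracePairing 1 ρ = 1 := by rw [tracePairing_apply, one_mul, hρ]
  have es : s 1 = ρ - s 0 := eq_sub_of_add_eq' hs
  have et : t 1 = ρ - t 0 := eq_sub_of_add_eq' ht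
  rw [es, et]
  simp only [mul_sub, mul_add, sub_mul, add_mul, smul_mul_assoc, mul_smul_comm, one_mul, mul_one,
    hr, map_add, map_sub, map_smul, LinearMap.add_apply, LinearMap.sub_apply,
    LinearMap.smul_apply, smul_eq_mul, h1]
  ring

/-- Tsirelson's bound, and its rigidity: at the maximum each term of the sum of squares vanishes,
so that `X = (C₁ - C₂)/√2` and `Y = (C₁ + C₂)/√2` reproduce the steered ensembles and anticommute
on the average state `ρ`. -/
theorem chsh_rigidity (hC₁ : IsSelfAdjoint C₁) (hC₂ : IsSelfAdjoint C₂)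
    (hp₁ : (1 - C₁ * C₁).IsPositive) (hp₂ : (1 - C₂ * C₂).IsPositive)
    (hsp : ∀ d, (s d : H →L[ℂ] H).IsPositive) (htp : ∀ d, (t d : H →L[ℂ] H).IsPositive)
    (hs : s 0 + s 1 = ρ) (ht : t 0 + t 1 = ρ) (hρ : opTrace (ρ : H →L[ℂ] H) = 1) :
    chsh C₁ C₂ s t ≤ 2 * √2 ∧ (chsh C₁ C₂ s t = 2 * √2 →
      ∃ X Y : H →L[ℂ] H, IsSelfAdjoint X ∧ IsSelfAdjoint Y ∧
        X * (ρ : H →L[ℂ] H) = (s 0 - s 1 : traceClass H) ∧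
        Y * (ρ : H →L[ℂ] H) = (t 0 - t 1 : traceClass H) ∧
        X * ((s 0 - s 1 : traceClass H) : H →L[ℂ] H) = ρ ∧
        Y * ((t 0 - t 1 : traceClass H) : H →L[ℂ] H) = ρ ∧
        (X * Y + Y * X) * (ρ : H →L[ℂ] H) = 0) := by
  have hr : ((√2 : ℝ) : ℂ) * ((√2 : ℝ) : ℂ) = 2 := by
    rw [← Complex.ofReal_mul, Real.mul_self_sqrt zero_le_two]; norm_num
  have hrr : √2 * √2 = 2 := Real.mul_self_sqrt zero_le_two
  have hr0 : 0 < √2 := by positivity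
  have hrsa : IsSelfAdjoint (((√2 : ℝ) : ℂ) • (1 : H →L[ℂ] H)) :=
    IsSelfAdjoint.smul (by simp [isSelfAdjoint_iff]) (.one _)
  have hρp : (ρ : H →L[ℂ] H).IsPositive := by
    rw [← hs]; exact (hsp 0).add (hsp 1)
  have key := congrArg Complex.re (chsh_sum_of_squares (C₁ := C₁) (C₂ := C₂) hs ht hρ hr)
  set r : ℂ := ((√2 : ℝ) : ℂ) with hrdef
  have p1 := (((hC₁.sub hC₂).sub hrsa)).isPositive_mul_self
  have p2 := (((hC₁.sub hC₂).add hrsa)).isPositive_mul_self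
  have p3 := (((hC₁.add hC₂).sub hrsa)).isPositive_mul_self
  have p4 := (((hC₁.add hC₂).add hrsa)).isPositive_mul_self
  have n1 := tracePairing_re_nonneg p1 (hsp 0)
  have n2 := tracePairing_re_nonneg p2 (hsp 1)
  have n3 := tracePairing_re_nonneg p3 (htp 0)
  have n4 := tracePairing_re_nonneg p4 (htp 1)
  have n5 := tracePairing_re_nonneg hp₁ hρp
  have n6 := tracePairing_re_nonneg hp₂ hρp
  have hv : (8 - 2 * r * (tracePairing (C₁ - C₂) (s 0 - s 1)
      + tracePairing (C₁ + C₂) (t 0 - t 1))).re = 8 - 2 * √2 * chsh C₁ C₂ s t := by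
    rw [hrdef, chsh]; simp
  rw [hv] at key
  simp only [Complex.add_re, Complex.re_ofNat, Complex.im_ofNat, Complex.mul_re, zero_mul,
    sub_zero] at key
  refine ⟨by nlinarith, fun hmax => ?_⟩
  have hz : 8 - 2 * √2 * (2 * √2) = 0 := by linear_combination (-4) * hrr
  rw [hmax, hz] at key
  have sq0 : ∀ {A : H →L[ℂ] H}, IsSelfAdjoint A → ∀ {T : traceClass H},
      (T : H →L[ℂ] H).IsPositive → (tracePairing (A * A) T).re = 0 →
      A * (T : H →L[ℂ] H) = 0 := by
    intro A hA T hT h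
    refine mul_eq_zero_of_opTrace_star_mul_mul T.2 hT ?_
    rwa [hA.star_eq]
  have z1 := sq0 ((hC₁.sub hC₂).sub hrsa) (hsp 0) (by linarith)
  have z2 := sq0 ((hC₁.sub hC₂).add hrsa) (hsp 1) (by linarith)
  have z3 := sq0 ((hC₁.add hC₂).sub hrsa) (htp 0) (by linarith)
  have z4 := sq0 ((hC₁.add hC₂).add hrsa) (htp 1) (by linarith)
  have z5 := mul_eq_zero_of_tracePairing_re hp₁ hρp (by linarith)
  have z6 := mul_eq_zero_of_tracePairing_re hp₂ hρp (by linarith)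
  have hrne : r ≠ 0 := by rw [hrdef]; exact_mod_cast hr0.ne'
  have hri : IsSelfAdjoint r⁻¹ := by simp [isSelfAdjoint_iff, hrdef]
  have hinv : r⁻¹ * r⁻¹ = 2⁻¹ := by rw [← mul_inv, hr]
  have e1 : ∀ {D T : H →L[ℂ] H}, (D - r • 1) * T = 0 → (r⁻¹ • D) * T = T := by
    intro D T h
    rw [sub_mul, smul_mul_assoc, one_mul, sub_eq_zero] at h
    rw [smul_mul_assoc, h, smul_smul, inv_mul_cancel₀ hrne, one_smul]
  have e2 : ∀ {D T : H →L[ℂ] H}, (D + r • 1) * T = 0 → (r⁻¹ • D) * T = -T := by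
    intro D T h
    rw [add_mul, smul_mul_assoc, one_mul, add_eq_zero_iff_eq_neg] at h
    rw [smul_mul_assoc, h, smul_neg, smul_smul, inv_mul_cancel₀ hrne, one_smul]
  refine ⟨r⁻¹ • (C₁ - C₂), r⁻¹ • (C₁ + C₂), hri.smul (hC₁.sub hC₂), hri.smul (hC₁.add hC₂),
    ?_, ?_, ?_, ?_, ?_⟩
  · rw [← hs, Submodule.coe_add, mul_add, e1 z1, e2 z2, Submodule.coe_sub, sub_eq_add_neg]
  · rw [← ht, Submodule.coe_add, mul_add, e1 z3, e2 z4, Submodule.coe_sub, sub_eq_add_neg]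
  · rw [← hs, Submodule.coe_sub, mul_sub, e1 z1, e2 z2, Submodule.coe_add, sub_neg_eq_add]
  · rw [← ht, Submodule.coe_sub, mul_sub, e1 z3, e2 z4, Submodule.coe_add, sub_neg_eq_add]
  · -- `XY + YX = C₁² - C₂²`, and both squares act as the identity on `ρ`.
    have h : (r⁻¹ • (C₁ - C₂)) * (r⁻¹ • (C₁ + C₂)) + (r⁻¹ • (C₁ + C₂)) * (r⁻¹ • (C₁ - C₂))
        = (1 - C₂ * C₂) - (1 - C₁ * C₁) := by
      simp only [smul_mul_assoc, mul_smul_comm, smul_smul, hinv, ← smul_add]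
      rw [inv_smul_eq_iff₀ two_ne_zero, ofNat_smul_eq_nsmul]
      noncomm_ring
    rw [h, sub_mul, z5, z6, sub_zero]

end CHSH

/-! ### Anticommuting triples and their matrix units -/

section Triple

variable {R : Type*} [Ring R]

/-- Three pairwise anticommuting square roots `X₀, X₁, X₂` of an idempotent `p`, all living in the
corner `p R p`. -/
structure IsAnticommutingTriple (p : R) (X : Fin 3 → R) : Prop where
  unit_mul : ∀ w, p * X w = X w
  mul_unit : ∀ w, X w * p = X w
  mul_self : ∀ w, X w * X w = p
  anticomm : ∀ v w, v ≠ w → X v * X w = -(X w * X v)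

variable [Algebra ℂ R] {p : R} {X : Fin 3 → R} {η : ℂ}

/-- The element `¼ (p - η X₀ X₁ X₂)(p + X₂)`. For `η = ±i` the first factor is twice the projection
onto the part where `X₀ X₁ X₂ = ηp`; there the triple consists of copies of the Pauli
matrices `(X, Y, Z)` for `η = i` and of their transposes for `η = -i`, and the second factor
cuts it down to the matrix unit `|0⟩⟨0|`. -/
noncomputable def corner (p : R) (X : Fin 3 → R) (η : ℂ) : R :=
  (1 / 4 : ℂ) • (p + X 2 - η • (X 0 * X 1) - η • (X 0 * X 1 * X 2))

/-- Part of the multiplication table of the matrix units `Q = |0⟩⟨0|` and `Q X₀ = |0⟩⟨1|` with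
`X₀, X₁, X₂`, and the fact that the two copies of `M₂(ℂ)` together exhaust `p`. Every product is
brought to the normal form `X₀ᵃ X₁ᵇ X₂ᶜ`. -/
theorem IsAnticommutingTriple.corner_relations (h : IsAnticommutingTriple p X)
    (hη : η * η = -1) :
    corner p X η * p = corner p X η ∧
    corner p X η * corner p X η = corner p X η ∧
    corner p X η * X 0 * corner p X η = 0 ∧
    corner p X η * X 2 = corner p X η ∧
    corner p X η * X 0 * X 2 = -(corner p X η * X 0) ∧
    corner p X η * X 0 * X 1 = η • corner p X η ∧
    corner p X η * X 1 = -η • (corner p X η * X 0) ∧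
    corner p X η + X 0 * corner p X η * X 0 + (corner p X (-η) + X 0 * corner p X (-η) * X 0)
      = p := by
  have c0 := h.unit_mul 0
  have c1 := h.unit_mul 1
  have c2 := h.unit_mul 2
  have d0 := h.mul_unit 0
  have d1 := h.mul_unit 1
  have d2 := h.mul_unit 2
  have s0 := h.mul_self 0
  have s1 := h.mul_self 1
  have s2 := h.mul_self 2
  have pp : p * p = p := by
    calc p * p = p * (X 0 * X 0) := by rw [s0]
      _ = p := by rw [← mul_assoc, c0, s0]
  have a1 := h.anticomm 1 0 (by decide)
  have a2 := h.anticomm 2 0 (by decide)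
  have a3 := h.anticomm 2 1 (by decide)
  have c0' : ∀ B, p * (X 0 * B) = X 0 * B := fun B => by rw [← mul_assoc, c0]
  have c1' : ∀ B, p * (X 1 * B) = X 1 * B := fun B => by rw [← mul_assoc, c1]
  have s0' : ∀ B, X 0 * (X 0 * B) = p * B := fun B => by rw [← mul_assoc, s0]
  have s1' : ∀ B, X 1 * (X 1 * B) = p * B := fun B => by rw [← mul_assoc, s1]
  have a1' : ∀ B, X 1 * (X 0 * B) = -(X 0 * (X 1 * B)) := fun B => by
    rw [← mul_assoc, a1, neg_mul, mul_assoc]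
  have a2' : ∀ B, X 2 * (X 0 * B) = -(X 0 * (X 2 * B)) := fun B => by
    rw [← mul_assoc, a2, neg_mul, mul_assoc]
  have a3' : ∀ B, X 2 * (X 1 * B) = -(X 1 * (X 2 * B)) := fun B => by
    rw [← mul_assoc, a3, neg_mul, mul_assoc]
  refine ⟨?_, ?_, ?_, ?_, ?_, ?_, ?_, ?_⟩ <;> unfold corner <;>
  simp only [mul_add, add_mul, mul_sub, sub_mul, smul_mul_assoc, mul_smul_comm, mul_assoc, pp,
    c0, c1, c2, d0, d1, d2, s0, s1, s2, a1, a2, a3, c0', c1', s0', s1', a1', a2', a3',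
    mul_neg, neg_mul, smul_neg, neg_neg] <;>
  match_scalars <;> grind

theorem IsAnticommutingTriple.isSelfAdjoint_corner [StarRing R] [StarModule ℂ R]
    (h : IsAnticommutingTriple p X) (hp : IsSelfAdjoint p) (hX : ∀ w, IsSelfAdjoint (X w))
    (hη : star η = -η) : IsSelfAdjoint (corner p X η) := by
  rw [isSelfAdjoint_iff, corner]
  simp only [star_smul, star_add, star_sub, star_mul, hp.star_eq, (hX _).star_eq, hη]
  have h1 : X 2 * (X 1 * X 0) = -(X 0 * X 1 * X 2) := by
    rw [h.anticomm 1 0 (by decide), mul_neg, ← mul_assoc, h.anticomm 2 0 (by decide), neg_mul,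
      mul_assoc, h.anticomm 2 1 (by decide), mul_neg, neg_neg, mul_assoc]
  rw [h1, h.anticomm 1 0 (by decide)]
  simp

theorem commute_corner {T : R} (hp : Commute p T) (hX : ∀ w, Commute (X w) T) :
    Commute (corner p X η) T :=
  ((((hp.add_left (hX 2)).sub_left (((hX 0).mul_left (hX 1)).smul_left _)).sub_left
    ((((hX 0).mul_left (hX 1)).mul_left (hX 2)).smul_left _))).smul_left _

end Triple

/-! ### Restriction to the support of the average state -/

section Support

variable {H : Type*} [NormedAddCommGroup H] [InnerProductSpace ℂ H] [CompleteSpace H]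

/-- The projection onto the closure of the range of a self-adjoint operator. -/
theorem exists_support (T : H →L[ℂ] H) (hT : IsSelfAdjoint T) :
    ∃ p : H →L[ℂ] H, IsSelfAdjoint p ∧ p * p = p ∧ p * T = T ∧ T * p = T ∧
      ∀ B : H →L[ℂ] H, B * T = 0 → B * p = 0 := by
  let K : Submodule ℂ H := (LinearMap.range (T : H →ₗ[ℂ] H)).topologicalClosure
  have : CompleteSpace K := (Submodule.isClosed_topologicalClosure _).completeSpace_coe
  have hpT : K.starProjection * T = T := by
    ext v
    exact Submodule.starProjection_eq_self_iff.2
      (Submodule.le_topologicalClosure _ (LinearMap.mem_range_self _ v))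
  have hsa : IsSelfAdjoint K.starProjection := isSelfAdjoint_starProjection K
  refine ⟨K.starProjection, hsa, K.isIdempotentElem_starProjection, hpT, ?_, fun B hB => ?_⟩
  · simpa [hT.star_eq, hsa.star_eq] using congrArg star hpT
  · ext v
    have hle : K ≤ LinearMap.ker (B : H →ₗ[ℂ] H) := by
      refine Submodule.topologicalClosure_minimal _ ?_ B.isClosed_ker
      rintro _ ⟨v, rfl⟩
      exact DFunLike.congr_fun hB v
    exact hle (K.starProjection_apply_mem v)

/-- Operators that square to the identity and anticommute on a state `T`, and commute with it,
form an anticommuting triple after restriction to the support of `T`. -/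
theorem exists_anticommutingTriple {T : H →L[ℂ] H} (hT : IsSelfAdjoint T)
    {X S : Fin 3 → H →L[ℂ] H} (hX : ∀ w, IsSelfAdjoint (X w)) (hS : ∀ w, IsSelfAdjoint (S w))
    (hXT : ∀ w, X w * T = S w) (hXS : ∀ w, X w * S w = T)
    (hanti : ∀ v w, v ≠ w → (X v * X w + X w * X v) * T = 0) :
    ∃ (p : H →L[ℂ] H) (Z : Fin 3 → H →L[ℂ] H), IsSelfAdjoint p ∧ p * p = p ∧ p * T = T ∧
      T * p = T ∧ (∀ w, IsSelfAdjoint (Z w)) ∧ IsAnticommutingTriple p Z ∧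
      (∀ w, Z w * T = S w) ∧ (∀ w, T * Z w = S w) := by
  obtain ⟨p, hp, hpp, hpT, hTp, hsupp⟩ := exists_support T hT
  have hTX : ∀ w, T * X w = S w := fun w => by
    simpa [(hX w).star_eq, hT.star_eq, (hS w).star_eq] using congrArg star (hXT w)
  have h1 : ∀ w, p * X w * p = X w * p := fun w => by
    have := hsupp (p * X w - X w) (by
      rw [sub_mul, mul_assoc, hXT, ← hTX, ← mul_assoc, hpT, sub_self])
    rwa [sub_mul, sub_eq_zero] at this
  have h2 : ∀ w, p * X w = X w * p := fun w => by
    have := congrArg star (h1 w)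
    simp only [star_mul, hp.star_eq, (hX w).star_eq, ← mul_assoc] at this
    rw [← this, h1]
  have h3 : ∀ v w, X v * p * (X w * p) = X v * X w * p := fun v w => by
    rw [mul_assoc, ← mul_assoc p, h1, mul_assoc]
  refine ⟨p, fun w => X w * p, hp, hpp, hpT, hTp, fun w => ?_, ⟨fun w => ?_, fun w => ?_,
    fun w => ?_, fun v w hvw => ?_⟩, fun w => ?_, fun w => ?_⟩
  · rw [isSelfAdjoint_iff, star_mul, hp.star_eq, (hX w).star_eq, h2]
  · rw [← mul_assoc, h1]
  · rw [mul_assoc, hpp]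
  · have := hsupp (X w * X w - 1) (by rw [sub_mul, mul_assoc, hXT, hXS, one_mul, sub_self])
    rw [h3]
    rwa [sub_mul, one_mul, sub_eq_zero] at this
  · rw [h3, h3, ← add_eq_zero_iff_eq_neg, ← add_mul]
    exact hsupp _ (hanti v w hvw)
  · rw [mul_assoc, hpT, hXT]
  · change T * (X w * p) = S w
    rw [← h2, ← mul_assoc, hTp, hTX]

end Support

/-! ### The extraction channel -/

section Extraction

variable {H : Type*} [NormedAddCommGroup H] [InnerProductSpace ℂ H]

/-- The operators `|0⟩⟨i|` of the copy of `M₂(ℂ)` singled out by `η`. -/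
noncomputable def cornerRow (p : H →L[ℂ] H) (X : Fin 3 → H →L[ℂ] H) (η : ℂ) :
    Fin 2 → H →L[ℂ] H :=
  ![corner p X η, corner p X η * X 0]

/-- The Pauli matrices on the block `s = 0`, their transposes on the block `s = 1`. -/
def blockPauli (s : Fin 2) (w : Fin 3) : Matrix (Fin 2) (Fin 2) ℂ :=
  if s = 0 then pauli w else (pauli w).transpose

/-- The value `±i` of the product of the three Pauli matrices (of their transposes). -/
noncomputable def blockPhase (s : Fin 2) : ℂ := if s = 0 then Complex.I else -Complex.I

theorem blockPhase_mul_self (s : Fin 2) : blockPhase s * blockPhase s = -1 := by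
  fin_cases s <;> simp [blockPhase]

theorem star_blockPhase (s : Fin 2) : star (blockPhase s) = -blockPhase s := by
  fin_cases s <;> simp [blockPhase]

variable {p : H →L[ℂ] H} {X : Fin 3 → H →L[ℂ] H}

/-- On the rows `|0⟩⟨i|` of a block the triple acts by the Pauli matrices or by their transposes. -/
theorem cornerRow_mul (h : IsAnticommutingTriple p X) (s i : Fin 2) (w : Fin 3) :
    cornerRow p X (blockPhase s) i * X w =
      ∑ k, blockPauli s w i k • cornerRow p X (blockPhase s) k := by
  obtain ⟨h1, -, -, h4, h5, h6, h7, -⟩ := h.corner_relations (blockPhase_mul_self s)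
  have h8 : corner p X (blockPhase s) * X 0 * X 0 = corner p X (blockPhase s) := by
    rw [mul_assoc, h.mul_self, h1]
  fin_cases s <;> fin_cases i <;> fin_cases w <;>
    simp_all [cornerRow, blockPauli, blockPhase, pauli, Fin.sum_univ_two]

variable [CompleteSpace H]

/-- `tr(|j⟩⟨i| A ρ) = mᵢⱼ tr(|0⟩⟨0| ρ)` when `A` acts on the rows of the block by the matrix `m`.
As `ρ` commutes with the matrix units, `B ↦ tr(B ρ)` is a trace on the block, and is hence a
multiple of the trace of `M₂(ℂ)`. -/
theorem tracePairing_cornerRow (h : IsAnticommutingTriple p X) (hp : IsSelfAdjoint p)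
    (hX : ∀ w, IsSelfAdjoint (X w)) {ρ : traceClass H} (hpρ : Commute p (ρ : H →L[ℂ] H))
    (hXρ : ∀ w, Commute (X w) (ρ : H →L[ℂ] H)) (s i j : Fin 2) {A : H →L[ℂ] H}
    {m : Matrix (Fin 2) (Fin 2) ℂ} {T : traceClass H}
    (hT : (T : H →L[ℂ] H) = A * (ρ : H →L[ℂ] H))
    (hA : ∀ i, cornerRow p X (blockPhase s) i * A =
      ∑ k, m i k • cornerRow p X (blockPhase s) k) :
    tracePairing (star (cornerRow p X (blockPhase s) j) * cornerRow p X (blockPhase s) i) T =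
      m i j * tracePairing (corner p X (blockPhase s)) ρ := by
  obtain ⟨h1, h2, h3, -⟩ := h.corner_relations (blockPhase_mul_self s)
  have hQ := h.isSelfAdjoint_corner hp hX (star_blockPhase s)
  have hrow : ∀ k, cornerRow p X (blockPhase s) k * star (cornerRow p X (blockPhase s) j) =
      if k = j then corner p X (blockPhase s) else 0 := by
    intro k
    fin_cases k <;> fin_cases j <;>
      simp [cornerRow, hQ.star_eq, (hX 0).star_eq, h2, h3, ← mul_assoc]
    · rw [mul_assoc _ (X 0) (X 0), h.mul_self, h1, h2]
  have hcomm : Commute (star (cornerRow p X (blockPhase s) j)) (ρ : H →L[ℂ] H) := by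
    have hQρ := commute_corner (η := blockPhase s) hpρ hXρ
    fin_cases j
    · simpa [cornerRow, hQ.star_eq] using hQρ
    · simpa [cornerRow, hQ.star_eq, (hX 0).star_eq] using (hXρ 0).mul_left hQρ
  have hk : ∀ k, tracePairing (star (cornerRow p X (blockPhase s) j) *
      cornerRow p X (blockPhase s) k) ρ =
      if k = j then tracePairing (corner p X (blockPhase s)) ρ else 0 := by
    intro k
    rw [tracePairing_apply, ← opTrace_mul_mul ρ.2, mul_assoc, ← hcomm.eq, ← mul_assoc, hrow]
    split_ifs
    · rfl
    · rw [zero_mul, opTrace_zero]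
  calc tracePairing (star (cornerRow p X (blockPhase s) j) * cornerRow p X (blockPhase s) i) T
      = tracePairing (star (cornerRow p X (blockPhase s) j) *
          (cornerRow p X (blockPhase s) i * A)) ρ := by
        simp only [tracePairing_apply, hT, mul_assoc]
    _ = ∑ k, m i k * tracePairing (star (cornerRow p X (blockPhase s) j) *
          cornerRow p X (blockPhase s) k) ρ := by
        rw [hA, Finset.mul_sum, map_sum, LinearMap.sum_apply]
        simp only [mul_smul_comm, map_smul, LinearMap.smul_apply, smul_eq_mul]
    _ = _ := by simp [hk]

/-- Kraus operators of the extraction: for `k = 0, 1` the rows of the two blocks, and for `k = 2`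
the complement of `p`, sent to a fixed basis vector so that the channel preserves the trace on all
of `H`. -/
noncomputable def extractionKraus (p : H →L[ℂ] H) (X : Fin 3 → H →L[ℂ] H) :
    Fin 3 → Fin 1 × Fin 2 × Fin 2 → H →L[ℂ] H :=
  ![fun q => if q.2.2 = 0 then cornerRow p X (blockPhase 0) q.2.1 else 0,
    fun q => if q.2.2 = 1 then cornerRow p X (blockPhase 1) q.2.1 else 0,
    fun q => if q.2 = (0, 0) then 1 - p else 0]

theorem isChannel_extraction (h : IsAnticommutingTriple p X) (hp : IsSelfAdjoint p)
    (hpp : p * p = p) (hX : ∀ w, IsSelfAdjoint (X w)) :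
    IsChannel (krausMap (extractionKraus p X)) := by
  refine isChannel_krausMap ?_
  obtain ⟨-, h2, -, -, -, -, -, h8⟩ := h.corner_relations (blockPhase_mul_self 0)
  obtain ⟨-, h2', -⟩ := h.corner_relations (blockPhase_mul_self 1)
  have hQ := h.isSelfAdjoint_corner hp hX (star_blockPhase 0)
  have hQ' := h.isSelfAdjoint_corner hp hX (star_blockPhase 1)
  have hpp' : (1 - p) * (1 - p) = 1 - p := by
    rw [mul_sub, mul_one, sub_mul, one_mul, hpp, sub_self, sub_zero]
  have e : -blockPhase 0 = blockPhase 1 := by simp [blockPhase]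
  rw [e] at h8
  have hh : ∀ Q : H →L[ℂ] H, Q * Q = Q → X 0 * Q * (Q * X 0) = X 0 * Q * X 0 := fun Q hQ => by
    rw [mul_assoc, ← mul_assoc Q, hQ, mul_assoc]
  simp [Fintype.sum_prod_type, Fin.sum_univ_two, Fin.sum_univ_three, extractionKraus, cornerRow,
    hQ.star_eq, hQ'.star_eq, hp.star_eq, (hX 0).star_eq, hh _ h2, hh _ h2', h2, h2', hpp']
  linear_combination (norm := abel) h8

/-- The extraction channel carries `A ρ` to the block-diagonal matrix with blocks proportional to
the matrices by which `A` acts on the rows. -/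
theorem krausMap_extraction_apply (h : IsAnticommutingTriple p X) (hp : IsSelfAdjoint p)
    (hX : ∀ w, IsSelfAdjoint (X w)) {ρ : traceClass H} (hpρ : Commute p (ρ : H →L[ℂ] H))
    (hXρ : ∀ w, Commute (X w) (ρ : H →L[ℂ] H)) {A : H →L[ℂ] H}
    {m : Fin 2 → Matrix (Fin 2) (Fin 2) ℂ} {T : traceClass H}
    (hT : (T : H →L[ℂ] H) = A * (ρ : H →L[ℂ] H)) (hpT : p * (T : H →L[ℂ] H) = T)
    (hA : ∀ s i, cornerRow p X (blockPhase s) i * A =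
      ∑ k, m s i k • cornerRow p X (blockPhase s) k) (i j s t : Fin 2) :
    krausMap (extractionKraus p X) T (0, i, s) (0, j, t) =
      if s = t then m s i j * tracePairing (corner p X (blockPhase s)) ρ else 0 := by
  have hc : tracePairing ((1 - star p) * (1 - p)) T = 0 := by
    rw [tracePairing_apply, mul_assoc, sub_mul 1 p, one_mul, hpT, sub_self, mul_zero, opTrace_zero]
  have hcore := fun s i j => tracePairing_cornerRow h hp hX hpρ hXρ s i j hT (hA s)
  rw [krausMap_apply]
  fin_cases s <;> fin_cases t <;> fin_cases i <;> fin_cases j <;>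
    simp [Fin.sum_univ_three, extractionKraus, hc, hcore]

end Extraction

/-! ### The marginal assemblage of Charlie and Dani -/

section Marginal

variable {H : Type*} [NormedAddCommGroup H] [InnerProductSpace ℂ H] [CompleteSpace H]
variable {A B X Y : Type*} [Fintype A] [Fintype B]
variable {σ : A → B → Fin 2 → X → Y → Fin 3 → traceClass H} {M : Fin 2 → Fin 6 → H →L[ℂ] H}

theorem IsAssemblage.sum_sum_eq (hσ : IsAssemblage σ) (x x' : X) (y y' : Y) (d : Fin 2)
    (w : Fin 3) : ∑ a, ∑ b, σ a b d x y w = ∑ a, ∑ b, σ a b d x' y' w := by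
  simp only [hσ.noSignallingB _ _ _ y y']
  rw [Finset.sum_comm]
  simp only [hσ.noSignallingA _ _ x x']
  exact Finset.sum_comm

theorem isPositive_coe_sum {ι : Type*} (s : Finset ι) {T : ι → traceClass H}
    (hT : ∀ i, (T i : H →L[ℂ] H).IsPositive) :
    ((∑ i ∈ s, T i : traceClass H) : H →L[ℂ] H).IsPositive := by
  rw [Submodule.coe_sum]
  exact ContinuousLinearMap.isPositive_sum s fun i _ => hT i

theorem marginalCD_correlations (x : X) (y : Y) (c d : Fin 2) (z : Fin 6) (w : Fin 3) :
    marginalCD (correlations σ M) x y c d z w =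
      (tracePairing (M c z) (∑ a, ∑ b, σ a b d x y w)).re := by
  simp only [marginalCD, correlations, map_sum, Complex.re_sum]
  rfl

theorem correlator_marginalCD (x : X) (y : Y) (z : Fin 6) (w : Fin 3) :
    correlator (marginalCD (correlations σ M) x y) z w =
      (tracePairing (observable fun c => M c z)
        (∑ a, ∑ b, σ a b 0 x y w - ∑ a, ∑ b, σ a b 1 x y w)).re := by
  simp only [correlator, marginalCD_correlations, Fin.sum_univ_two, observable, map_sub,
    LinearMap.sub_apply, Complex.sub_re]
  simp
  ring

/-- `I^CD` is a sum of three CHSH expressions, one for each pair of Dani's measurements. -/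
theorem bellCD_eq_add_chsh (x : X) (y : Y) {τ : Fin 2 → Fin 3 → traceClass H}
    (hτ : ∀ d w, ∑ a, ∑ b, σ a b d x y w = τ d w) :
    bellCD (marginalCD (correlations σ M) x y) =
      chsh (observable fun c => M c 0) (observable fun c => M c 1) (τ · 0) (τ · 1)
      + chsh (observable fun c => M c 2) (observable fun c => M c 3) (τ · 2) (τ · 0)
      + chsh (observable fun c => M c 4) (observable fun c => M c 5) (τ · 2) (τ · 1) := by
  simp only [bellCD, correlator_marginalCD, hτ, chsh, map_sub, map_add, LinearMap.sub_apply,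
    LinearMap.add_apply, Complex.sub_re, Complex.add_re]
  ring

end Marginal

/-! ### Self-testing of the Pauli assemblage -/

section SelfTest

variable {H : Type*} [NormedAddCommGroup H] [InnerProductSpace ℂ H] [CompleteSpace H]

/-- Three maximal CHSH violations, one for each pair of Dani's measurements, give operators on
Charlie's side that reproduce Dani's steered ensembles and anticommute pairwise on the average
state. Different pairs may yield different operators for the same measurement of Dani, but these
agree on that state. -/
theorem exists_anticommuting_observables {C : Fin 6 → H →L[ℂ] H}
    (hC : ∀ z, IsSelfAdjoint (C z)) (hCp : ∀ z, (1 - C z * C z).IsPositive)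
    {τ : Fin 2 → Fin 3 → traceClass H} {ρ : traceClass H}
    (hpos : ∀ d w, (τ d w : H →L[ℂ] H).IsPositive) (hsum : ∀ w, τ 0 w + τ 1 w = ρ)
    (htr : opTrace (ρ : H →L[ℂ] H) = 1)
    (hmax : chsh (C 0) (C 1) (τ · 0) (τ · 1) + chsh (C 2) (C 3) (τ · 2) (τ · 0)
      + chsh (C 4) (C 5) (τ · 2) (τ · 1) = 6 * √2) :
    ∃ X : Fin 3 → H →L[ℂ] H, (∀ w, IsSelfAdjoint (X w)) ∧
      (∀ w, X w * (ρ : H →L[ℂ] H) = (τ 0 w - τ 1 w : traceClass H)) ∧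
      (∀ w, X w * ((τ 0 w - τ 1 w : traceClass H) : H →L[ℂ] H) = ρ) ∧
      ∀ v w, v ≠ w → (X v * X w + X w * X v) * (ρ : H →L[ℂ] H) = 0 := by
  have hρsa : IsSelfAdjoint (ρ : H →L[ℂ] H) := by
    rw [← hsum 0]
    exact ((hpos 0 0).add (hpos 1 0)).isSelfAdjoint
  have key := fun z z' w w' => chsh_rigidity (hC z) (hC z') (hCp z) (hCp z')
    (s := (τ · w)) (t := (τ · w')) (hpos · w) (hpos · w') (hsum w) (hsum w') htr
  obtain ⟨b1, k1⟩ := key 0 1 0 1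
  obtain ⟨b2, k2⟩ := key 2 3 2 0
  obtain ⟨b3, k3⟩ := key 4 5 2 1
  obtain ⟨X, Y, hX, hY, hXρ, hYρ, hXS, hYS, hXY⟩ := k1 (by linarith)
  obtain ⟨Z, X', hZ, -, hZρ, hXρ', hZS, -, hZX⟩ := k2 (by linarith)
  obtain ⟨Z', Y', -, -, hZρ', hYρ', -, -, hZY⟩ := k3 (by linarith)
  -- `ρ U` is the adjoint of `U ρ = S_w`, which is self-adjoint.
  have hcomm : ∀ {U : H →L[ℂ] H} {w : Fin 3}, IsSelfAdjoint U →
      U * (ρ : H →L[ℂ] H) = (τ 0 w - τ 1 w : traceClass H) →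
      (ρ : H →L[ℂ] H) * U = U * (ρ : H →L[ℂ] H) := by
    intro U w hU h
    have hS : IsSelfAdjoint ((τ 0 w - τ 1 w : traceClass H) : H →L[ℂ] H) :=
      (hpos 0 w).isSelfAdjoint.sub (hpos 1 w).isSelfAdjoint
    have := congrArg star h
    rwa [star_mul, hU.star_eq, hρsa.star_eq, hS.star_eq, ← h] at this
  -- Products of two operators acting on `ρ` depend only on the action of each of them on `ρ`.
  have hprod : ∀ {U U' V V' : H →L[ℂ] H}, U * (ρ : H →L[ℂ] H) = U' * (ρ : H →L[ℂ] H) →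
      V * (ρ : H →L[ℂ] H) = V' * (ρ : H →L[ℂ] H) →
      (ρ : H →L[ℂ] H) * V = V * (ρ : H →L[ℂ] H) →
      U * V * (ρ : H →L[ℂ] H) = U' * V' * (ρ : H →L[ℂ] H) := by
    intro U U' V V' hU hV hc
    rw [mul_assoc, ← hc, ← mul_assoc, hU, mul_assoc, hc, hV, mul_assoc]
  have cX := hcomm hX hXρ
  have cY := hcomm hY hYρ
  have cZ := hcomm hZ hZρ
  have hZX' : (Z * X + X * Z) * (ρ : H →L[ℂ] H) = 0 := by
    rw [add_mul] at hZX ⊢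
    rw [hprod rfl (hXρ.trans hXρ'.symm) cX, hprod (hXρ.trans hXρ'.symm) rfl cZ, hZX]
  have hZY' : (Z * Y + Y * Z) * (ρ : H →L[ℂ] H) = 0 := by
    rw [add_mul] at hZY ⊢
    rw [hprod (hZρ.trans hZρ'.symm) (hYρ.trans hYρ'.symm) cY,
      hprod (hYρ.trans hYρ'.symm) (hZρ.trans hZρ'.symm) cZ, hZY]
  refine ⟨![X, Y, Z], ?_, ?_, ?_, ?_⟩
  · intro w; fin_cases w <;> assumption
  · intro w; fin_cases w <;> assumption
  · intro w; fin_cases w <;> assumption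
  · intro v w hvw
    fin_cases v <;> fin_cases w <;> first
      | exact absurd rfl hvw
      | assumption
      | (rw [add_comm]; assumption)

/-- An assemblage `τ_{d|w} = (ρ + (-1)^d X_w ρ)/2` generated by an anticommuting triple that
commutes with the average state `ρ` is the reference assemblage up to a channel. The auxiliary
state can be taken trivial, and the weight `r` is the probability of the block on which
the triple is Pauli. -/
theorem isReference_of_anticommutingTriple {τ : Fin 2 → Fin 3 → traceClass H} {ρ : traceClass H}
    (hρ : (ρ : H →L[ℂ] H).IsPositive) (hsum : ∀ w, τ 0 w + τ 1 w = ρ)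
    (htr : opTrace (ρ : H →L[ℂ] H) = 1) {p : H →L[ℂ] H} {X : Fin 3 → H →L[ℂ] H}
    (hp : IsSelfAdjoint p) (hpp : p * p = p) (hpρ : p * (ρ : H →L[ℂ] H) = ρ)
    (hρp : (ρ : H →L[ℂ] H) * p = ρ) (hX : ∀ w, IsSelfAdjoint (X w))
    (h : IsAnticommutingTriple p X)
    (hXρ : ∀ w, X w * (ρ : H →L[ℂ] H) = (τ 0 w - τ 1 w : traceClass H))
    (hρX : ∀ w, (ρ : H →L[ℂ] H) * X w = (τ 0 w - τ 1 w : traceClass H)) :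
    IsReference τ := by
  have hcp : Commute p (ρ : H →L[ℂ] H) := hpρ.trans hρp.symm
  have hcX : ∀ w, Commute (X w) (ρ : H →L[ℂ] H) := fun w => (hXρ w).trans (hρX w).symm
  have hch := isChannel_extraction h hp hpp hX
  set c : Fin 2 → ℂ := fun s => tracePairing (corner p X (blockPhase s)) ρ
  have hc0 : ∀ s, 0 ≤ c s := fun s => by
    have hQ := h.isSelfAdjoint_corner hp hX (star_blockPhase s)
    obtain ⟨-, h2, -⟩ := h.corner_relations (blockPhase_mul_self s)
    have := opTrace_star_mul_mul_nonneg (A := corner p X (blockPhase s)) ρ.2 hρ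
    rwa [hQ.star_eq, h2] at this
  have hΛρ : ∀ i j s t, krausMap (extractionKraus p X) ρ (0, i, s) (0, j, t) =
      if s = t then (1 : Matrix (Fin 2) (Fin 2) ℂ) i j * c s else 0 :=
    krausMap_extraction_apply (m := fun _ => 1) h hp hX hcp hcX (one_mul _).symm hpρ
      (fun s i => by simp [Matrix.one_apply])
  have hΛS : ∀ w i j s t, krausMap (extractionKraus p X) (τ 0 w - τ 1 w) (0, i, s) (0, j, t) =
      if s = t then blockPauli s w i j * c s else 0 := fun w =>
    krausMap_extraction_apply (m := fun s => blockPauli s w) h hp hX hcp hcX (hXρ w).symm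
      (by rw [← hXρ, ← mul_assoc, h.unit_mul]) (fun s i => cornerRow_mul h s i w)
  have hcsum : 2 * c 0 + 2 * c 1 = 1 := by
    rw [← htr, ← hch.tracePreserving ρ]
    simp only [Matrix.trace, Matrix.diag, Fintype.sum_prod_type, Fin.sum_univ_two,
      Fin.sum_univ_one, hΛρ]
    simp
    ring
  have hcre : ∀ s, c s = ((c s).re : ℂ) := fun s =>
    Complex.ext rfl (by simpa using (Complex.le_def.1 (hc0 s)).2.symm)
  have hre : 2 * (c 0).re + 2 * (c 1).re = 1 := by
    simpa using congrArg Complex.re hcsum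
  have hn : ∀ s, 0 ≤ (c s).re := fun s => (Complex.le_def.1 (hc0 s)).1
  refine ⟨2 * (c 0).re, by linarith [hn 0], by linarith [hn 1], 1, 1,
    krausMap (extractionKraus p X), .one, by simp, hch, fun d w => ?_⟩
  have hτ : τ d w = (1 / 2 : ℂ) • (ρ + (-1 : ℂ) ^ (d : ℕ) • (τ 0 w - τ 1 w)) := by
    rw [← hsum w]
    fin_cases d <;> simp <;> module
  have h1 : ((2 * (c 0).re : ℝ) : ℂ) = 2 * c 0 := by rw [hcre 0]; simp
  have h2 : ((1 - 2 * (c 0).re : ℝ) : ℂ) = 2 * c 1 := by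
    rw [Complex.ofReal_sub, h1, Complex.ofReal_one]
    linear_combination -hcsum
  -- Block `s` of the image has weight `2 c s`; the blocks are matched entry by entry.
  ext ⟨u, i, s⟩ ⟨v, j, t⟩
  obtain rfl := Subsingleton.elim u 0
  obtain rfl := Subsingleton.elim v 0
  rw [hτ, map_smul, map_add, map_smul]
  simp only [Matrix.smul_apply, Matrix.add_apply, hΛρ, hΛS, smul_eq_mul,
    Matrix.kroneckerMap_apply, referenceAssemblage, h1, h2, pauliAssemblage,
    Matrix.transpose_apply, Matrix.one_apply_eq]
  fin_cases s <;> fin_cases t <;> simp [blockPauli, Matrix.one_apply, eq_comm (a := j)] <;>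
    split_ifs <;> ring

end SelfTest

end PostQuantumSelfTest

theorem mainTheorem3 {H : Type*} [NormedAddCommGroup H] [InnerProductSpace ℂ H]
    [CompleteSpace H] {A B X Y : Type*} [Fintype A] [Fintype B]
    (σ : A → B → Fin 2 → X → Y → Fin 3 → traceClass H) (hσ : IsAssemblage σ)
    (M : Fin 2 → Fin 6 → H →L[ℂ] H) (hM : ∀ z, IsMeasurement fun c => M c z)
    (x₀ : X) (y₀ : Y)
    (hmax : bellCD (marginalCD (correlations σ M) x₀ y₀) = 6 * Real.sqrt 2) :
    ∃ τ : Fin 2 → Fin 3 → traceClass H,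
      (∀ x y d w, ∑ a, ∑ b, σ a b d x y w = τ d w) ∧ IsReference τ := by
  let τ : Fin 2 → Fin 3 → traceClass H := fun d w => ∑ a, ∑ b, σ a b d x₀ y₀ w
  refine ⟨τ, fun x y d w => hσ.sum_sum_eq x x₀ y y₀ d w, ?_⟩
  have hpos : ∀ d w, (τ d w : H →L[ℂ] H).IsPositive := fun d w =>
    isPositive_coe_sum _ fun a => isPositive_coe_sum _ fun b => hσ.positive a b d x₀ y₀ w
  have hd : ∀ w, τ 0 w + τ 1 w = ∑ a, ∑ b, ∑ d, σ a b d x₀ y₀ w := fun w => by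
    simp only [τ, Fin.sum_univ_two, Finset.sum_add_distrib]
  have hsum : ∀ w, τ 0 w + τ 1 w = τ 0 0 + τ 1 0 := fun w => by
    rw [hd, hd]
    simp only [hσ.noSignallingD _ _ _ _ w 0]
  have htr : opTrace ((τ 0 0 + τ 1 0 : traceClass H) : H →L[ℂ] H) = 1 := by
    rw [hd]
    exact hσ.normalised x₀ y₀ 0
  have hρ : ((τ 0 0 + τ 1 0 : traceClass H) : H →L[ℂ] H).IsPositive :=
    (hpos 0 0).add (hpos 1 0)
  rw [bellCD_eq_add_chsh x₀ y₀ (τ := τ) fun _ _ => rfl] at hmax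
  obtain ⟨U, hU, hUρ, hUS, hanti⟩ := exists_anticommuting_observables
    (C := fun z => observable fun c => M c z) (fun z => (hM z).isSelfAdjoint_observable)
    (fun z => (hM z).isPositive_one_sub_observable_sq) hpos hsum htr hmax
  obtain ⟨p, Z, hp, hpp, hpρ, hρp, hZ, h, hZρ, hρZ⟩ := exists_anticommutingTriple
    hρ.isSelfAdjoint hU
    (fun w => (hpos 0 w).isSelfAdjoint.sub (hpos 1 w).isSelfAdjoint) hUρ hUS hanti
  exact isReference_of_anticommutingTriple hρ hsum htr hp hpp hpρ hρp hZ h hZρ hρZ
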